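/- **Setting.** A finite metric graph has finitely many internal edges $i\in\mathcal I$, identified with intervals $I_i=[0,a_i]$, $a_i>0$, and finitely many external edges $e\in\mathcal E$, identified with $I_e=[0,\infty)$; write $\underline a=\{a_i\}_{i\in\mathcal I}$. Put $\mathcal H=\bigoplus_{j\in\mathcal E\cup\mathcal I}L^2(I_j)$, $\mathcal K=\mathbb C^{\mathcal E}\oplus\mathbb C^{\mathcal I}\oplus\mathbb C^{\mathcal I}$, and let $\mathcal D$ be the set of $\psi=(\psi_j)\in\mathcal H$ such that $\psi_j,\psi_j'$ are absolutely continuous (on compact subintervals of $I_j$) and $\psi_j''\in L^2(I_j)$. For $\psi\in\mathcal D$ let $$\underline\psi=\big(\{\psi_e(0)\}_{e},\{\psi_i(0)\}_{i},\{\psi_i(a_i)\}_{i}\big),\qquad \underline\psi'=\big(\{\psi_e'(0)\}_{e},\{\psi_i'(0)\}_{i},\{-\psi_i'(a_i)\}_{i}\big),\qquad [\psi]=(\underline\psi,\underline\psi')\in\mathcal K\oplus\mathcal K .$$ A subspace $\mathcal M\subset\mathcal K\oplus\mathcal K$ is *maximal isotropic* if it is maximal among the subspaces on which the form $\omega(\chi,\eta)=\langle\chi_1,\eta_2\rangle-\langle\chi_2,\eta_1\rangle$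 vanishes. For such $\mathcal M$ the Laplace operator $\Delta(\mathcal M,\underline a)$ on $\mathcal H$ acts as $(\Delta\psi)_j=\psi_j''$ on the domain $\{\psi\in\mathcal D\mid[\psi]\in\mathcal M\}$. The maximal isotropic subspaces are exactly the subspaces $\mathcal M(A,B)=\{(\chi_1,\chi_2)\mid A\chi_1+B\chi_2=0\}$, where $A,B$ are linear maps on $\mathcal K$ such that $(A,B):\mathcal K\oplus\mathcal K\to\mathcal K$ has rank $\dim\mathcal K$ and $AB^\dagger=BA^\dagger$. For such $A,B$ let $L=(B|_{\operatorname{Ran}B^\dagger})^{-1}AP_{(\operatorname{Ker}B)^\perp}$, where $B|_{\operatorname{Ran}B^\dagger}$ is regarded as a bijection onto $\operatorname{Ran}B$ and $P_{(\operatorname{Ker}B)^\perp}$ is the orthogonal projection onto $(\operatorname{Ker}B)^\perp$; $L$ is a self-adjoint operator on $\mathcal K$, and $L_+$ denotes its positive part. **Theorem.** Assume $\mathcal I\neq\emptyset$ and let $a=\min_{i\in\mathcal I}a_i$. For every $t\ge0$ the equation $$s\tanh\!\left(\frac{as}{2}\right)=t$$ has a unique nonnegative solution $s=s(t)$, and for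 every maximal isotropic subspace $\mathcal M\subset\mathcal K\oplus\mathcal K$ and all $A,B$ as above with $\mathcal M=\mathcal M(A,B)$, $$-\Delta(\mathcal M,\underline a)\ \ge\ -s(\|L_+\|)^2$$ in the sense of quadratic forms, that is, $\langle\psi,-\Delta(\mathcal M,\underline a)\psi\rangle_{\mathcal H}$ is real and at least $-s(\|L_+\|)^2\,\|\psi\|_{\mathcal H}^2$ for every $\psi$ in the domain of $\Delta(\mathcal M,\underline a)$. -/

import Mathlib

open MeasureTheory Set

noncomputable section

namespace QuantumGraph

/-! ## Boundary conditions: Hermitian symplectic linear algebra -/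

section Symplectic

variable {K : Type*} [NormedAddCommGroup K] [InnerProductSpace ℂ K]

/-- The canonical Hermitian symplectic form `ω(χ, η) = ⟨χ, J η⟩` on the double `K ⊕ K`,
where `J (η₁, η₂) = (η₂, -η₁)`; the scalar product is antilinear in the first argument. -/
def omega (χ η : K × K) : ℂ := inner ℂ χ.1 η.2 + inner ℂ χ.2 (-η.1)

/-- A subspace of `K ⊕ K` is isotropic if `ω` vanishes identically on it. -/
def IsIsotropic (M : Submodule ℂ (K × K)) : Prop := ∀ χ ∈ M, ∀ η ∈ M, omega χ η = 0

/-- A maximal isotropic subspace: an isotropic subspace that is not a proper subspace of a larger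
isotropic subspace. -/
def IsMaximalIsotropic (M : Submodule ℂ (K × K)) : Prop :=
  IsIsotropic M ∧ ∀ N : Submodule ℂ (K × K), IsIsotropic N → M ≤ N → N = M

variable [FiniteDimensional ℂ K]

variable (K) in
/-- A pair `(A, B)` of linear maps on `K` such that `(A, B) : K ⊕ K → K` has maximal rank and
`A B†` is self-adjoint. -/
structure BoundaryConditions where
  A : K →L[ℂ] K
  B : K →L[ℂ] K
  maximal_rank :
    Module.finrank ℂ (LinearMap.range (A.toLinearMap.coprod B.toLinearMap)) = Module.finrank ℂ K
  selfAdjoint : A ∘L B.adjoint = B ∘L A.adjoint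

namespace BoundaryConditions

variable (bc : BoundaryConditions K)

/-- The subspace `M(A, B) = Ker (A, B) = {(χ₁, χ₂) | A χ₁ + B χ₂ = 0}`. -/
def subspace : Submodule ℂ (K × K) := LinearMap.ker (bc.A.toLinearMap.coprod bc.B.toLinearMap)

theorem mem_subspace {χ : K × K} : χ ∈ bc.subspace ↔ bc.A χ.1 + bc.B χ.2 = 0 := by
  simp [subspace]

theorem ker_orthogonal : (LinearMap.ker bc.B.toLinearMap)ᗮ
    = LinearMap.range bc.B.adjoint.toLinearMap := by
  have h : (LinearMap.range bc.B.adjoint.toLinearMap)ᗮ = LinearMap.ker bc.B.toLinearMap := by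
    simpa using ContinuousLinearMap.orthogonal_range bc.B.adjoint
  rw [← h, Submodule.orthogonal_orthogonal]

/-- The restriction of `B` to `Ran B†`, as a map onto `Ran B`. -/
def restrictB : LinearMap.range bc.B.adjoint.toLinearMap →ₗ[ℂ] LinearMap.range bc.B.toLinearMap :=
  LinearMap.rangeRestrict bc.B.toLinearMap ∘ₗ
    (LinearMap.range bc.B.adjoint.toLinearMap).subtype

theorem restrictB_bijective : Function.Bijective bc.restrictB := by
  constructor
  · rw [injective_iff_map_eq_zero]
    rintro ⟨x, hx⟩ h
    have h0 : bc.B x = 0 := congrArg Subtype.val h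
    rw [← bc.ker_orthogonal] at hx
    have : inner ℂ x x = (0 : ℂ) := hx x h0
    ext1
    simpa using this
  · rintro ⟨_, ⟨x, rfl⟩⟩
    have hx := Submodule.exists_add_mem_mem_orthogonal (K := LinearMap.ker bc.B.toLinearMap) x
    obtain ⟨y, hy, z, hz, rfl⟩ := hx
    rw [bc.ker_orthogonal] at hz
    refine ⟨⟨z, hz⟩, ?_⟩
    ext1
    have hy0 : bc.B y = 0 := hy
    simp [restrictB, hy0]

/-- The operator `A P_{(Ker B)^⊥}` takes its values in `Ran B`. -/
theorem A_proj_mem_range (χ : K) :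
    bc.A ((LinearMap.ker bc.B.toLinearMap)ᗮ.starProjection χ) ∈
      LinearMap.range bc.B.toLinearMap := by
  have h : (LinearMap.ker bc.B.toLinearMap)ᗮ.starProjection χ
      ∈ LinearMap.range bc.B.adjoint.toLinearMap := by
    rw [← bc.ker_orthogonal]
    exact Submodule.starProjection_apply_mem _ _
  obtain ⟨y, hy⟩ := h
  refine ⟨bc.A.adjoint y, ?_⟩
  rw [← hy]
  exact (DFunLike.congr_fun bc.selfAdjoint y).symm

/-- Kuchment's operator `L = (B|_{Ran B†})⁻¹ A P_{(Ker B)^⊥}`, where `B|_{Ran B†}` is regarded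
as a bijection of `Ran B†` onto `Ran B`. -/
def kuchment : K →L[ℂ] K :=
  LinearMap.toContinuousLinearMap
    ((LinearMap.range bc.B.adjoint.toLinearMap).subtype ∘ₗ
      (LinearEquiv.ofBijective bc.restrictB bc.restrictB_bijective).symm.toLinearMap ∘ₗ
      LinearMap.codRestrict (LinearMap.range bc.B.toLinearMap)
        (bc.A.toLinearMap ∘ₗ
          ((LinearMap.ker bc.B.toLinearMap)ᗮ.starProjection).toLinearMap)
        bc.A_proj_mem_range)

theorem B_kuchment (χ : K) :
    bc.B (bc.kuchment χ) = bc.A ((LinearMap.ker bc.B.toLinearMap)ᗮ.starProjection χ) := by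
  have h := (LinearEquiv.ofBijective bc.restrictB bc.restrictB_bijective).apply_symm_apply
    ⟨_, bc.A_proj_mem_range χ⟩
  exact congrArg Subtype.val h

theorem kuchment_mem (χ : K) :
    bc.kuchment χ ∈ LinearMap.range bc.B.adjoint.toLinearMap :=
  ((LinearEquiv.ofBijective bc.restrictB bc.restrictB_bijective).symm
    ⟨_, bc.A_proj_mem_range χ⟩).2

/-- `L` is self-adjoint, so that its positive part makes sense. -/
theorem kuchment_isSelfAdjoint : IsSelfAdjoint bc.kuchment := by
  rw [ContinuousLinearMap.isSelfAdjoint_iff_isSymmetric]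
  intro χ η
  set P := (LinearMap.ker bc.B.toLinearMap)ᗮ.starProjection with hP
  have hmem : ∀ v, P v ∈ LinearMap.range bc.B.adjoint.toLinearMap := fun v => by
    rw [← bc.ker_orthogonal]
    exact Submodule.starProjection_apply_mem _ _
  have hfix : ∀ v, P (bc.kuchment v) = bc.kuchment v := fun v =>
    Submodule.starProjection_eq_self_iff.2 (by rw [bc.ker_orthogonal]; exact bc.kuchment_mem v)
  have hsym : ∀ u v, inner ℂ (P u) v = inner ℂ u (P v) := fun u v =>
    Submodule.inner_starProjection_left_eq_right _ u v
  obtain ⟨x, hx⟩ := hmem χ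
  obtain ⟨y, hy⟩ := hmem η
  change bc.B.adjoint x = P χ at hx
  change bc.B.adjoint y = P η at hy
  change inner ℂ (bc.kuchment χ) η = inner ℂ χ (bc.kuchment η)
  have h1 : inner ℂ (bc.kuchment χ) η = inner ℂ (bc.A (bc.B.adjoint x)) y := by
    rw [← hfix, hsym, ← hy, ContinuousLinearMap.adjoint_inner_right, bc.B_kuchment, ← hP, hx]
  have h2 : inner ℂ χ (bc.kuchment η) = inner ℂ x (bc.A (bc.B.adjoint y)) := by
    rw [← hfix, ← hsym, ← hx, ContinuousLinearMap.adjoint_inner_left, bc.B_kuchment, ← hP, hy]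
  have h3 : bc.A (bc.B.adjoint x) = bc.B (bc.A.adjoint x) := DFunLike.congr_fun bc.selfAdjoint x
  rw [h1, h2, h3, ← ContinuousLinearMap.adjoint_inner_right,
    ContinuousLinearMap.adjoint_inner_left]

/-- The positive part `L₊` of `L` (functional calculus with `x ↦ max x 0`). -/
def kuchmentPos : K →L[ℂ] K := bc.kuchment⁺

end BoundaryConditions

theorem BoundaryConditions.coprod_surjective (bc : BoundaryConditions K) (y : K) :
    ∃ χ : K × K, bc.A χ.1 + bc.B χ.2 = y := by
  have h := Submodule.eq_top_of_finrank_eq bc.maximal_rank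
  obtain ⟨χ, hχ⟩ := LinearMap.range_eq_top.1 h y
  exact ⟨χ, by simpa using hχ⟩

/-- The frame description `M(A, B) = Ran (-B, A)†`. -/
theorem BoundaryConditions.mem_subspace_iff_exists (bc : BoundaryConditions K) {χ : K × K} :
    χ ∈ bc.subspace ↔ ∃ x, χ = (-bc.B.adjoint x, bc.A.adjoint x) := by
  set F : K →ₗ[ℂ] K × K := (-bc.B.adjoint.toLinearMap).prod bc.A.adjoint.toLinearMap with hF
  have hinj : Function.Injective F := by
    rw [injective_iff_map_eq_zero]
    intro x hx
    have h1 : bc.B.adjoint x = 0 := by simpa [hF] using congrArg Prod.fst hx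
    have h2 : bc.A.adjoint x = 0 := by simpa [hF] using congrArg Prod.snd hx
    obtain ⟨χ, hχ⟩ := bc.coprod_surjective x
    have : inner ℂ x x = (0 : ℂ) := by
      nth_rewrite 2 [← hχ]
      rw [inner_add_right, ← ContinuousLinearMap.adjoint_inner_left,
        ← ContinuousLinearMap.adjoint_inner_left, h1, h2]
      simp
    simpa using this
  have hle : LinearMap.range F ≤ bc.subspace := by
    rintro _ ⟨x, rfl⟩
    have h3 : bc.A (bc.B.adjoint x) = bc.B (bc.A.adjoint x) :=
      DFunLike.congr_fun bc.selfAdjoint x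
    rw [bc.mem_subspace]
    simp [hF, h3]
  have heq : LinearMap.range F = bc.subspace := by
    apply Submodule.eq_of_le_of_finrank_eq hle
    rw [LinearMap.finrank_range_of_inj hinj]
    have := LinearMap.finrank_range_add_finrank_ker (bc.A.toLinearMap.coprod bc.B.toLinearMap)
    rw [bc.maximal_rank, Module.finrank_prod] at this
    exact (Nat.add_left_cancel this).symm
  rw [← heq]
  constructor
  · rintro ⟨x, rfl⟩
    exact ⟨x, rfl⟩
  · rintro ⟨x, rfl⟩
    exact ⟨x, rfl⟩

theorem BoundaryConditions.isMaximalIsotropic (bc : BoundaryConditions K) :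
    IsMaximalIsotropic bc.subspace := by
  have key : ∀ x (η : K × K), omega (-bc.B.adjoint x, bc.A.adjoint x) η
      = -inner ℂ x (bc.A η.1 + bc.B η.2) := by
    intro x η
    simp only [omega, inner_add_right, inner_neg_left, inner_neg_right,
      ContinuousLinearMap.adjoint_inner_left]
    ring
  refine ⟨?_, fun N hN hle => le_antisymm (fun η hη => ?_) hle⟩
  · intro χ hχ η hη
    obtain ⟨x, rfl⟩ := bc.mem_subspace_iff_exists.1 hχ
    rw [key, bc.mem_subspace.1 hη]
    simp
  · rw [bc.mem_subspace]
    have h := hN _ (hle (bc.mem_subspace_iff_exists.2 ⟨bc.A η.1 + bc.B η.2, rfl⟩)) η hη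
    rw [key] at h
    simpa using h

theorem IsMaximalIsotropic.exists_boundaryConditions {M : Submodule ℂ (K × K)}
    (hM : IsMaximalIsotropic M) : ∃ bc : BoundaryConditions K, bc.subspace = M := by
  -- the Cayley transform `χ₁ + i χ₂ ↦ χ₁ - i χ₂` of `M` is isometric
  have hnorm : ∀ χ ∈ M, ‖χ.1 - Complex.I • χ.2‖ = ‖χ.1 + Complex.I • χ.2‖ := by
    intro χ hχ
    have h0 : (inner ℂ χ.1 χ.2 : ℂ) - inner ℂ χ.2 χ.1 = 0 := by
      have := hM.1 χ hχ χ hχ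
      simpa [omega, sub_eq_add_neg] using this
    have h1 : (inner ℂ (χ.1 - Complex.I • χ.2) (χ.1 - Complex.I • χ.2) : ℂ)
        = inner ℂ (χ.1 + Complex.I • χ.2) (χ.1 + Complex.I • χ.2) := by
      simp only [inner_sub_left, inner_sub_right, inner_add_left, inner_add_right,
        inner_smul_left, inner_smul_right, Complex.conj_I]
      linear_combination (-2 * Complex.I) * h0
    rw [inner_self_eq_norm_sq_to_K, inner_self_eq_norm_sq_to_K] at h1
    have h2 : ‖χ.1 - Complex.I • χ.2‖ ^ 2 = ‖χ.1 + Complex.I • χ.2‖ ^ 2 := by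
      exact_mod_cast h1
    exact (pow_left_inj₀ (norm_nonneg _) (norm_nonneg _) two_ne_zero).1 h2
  set p : M →ₗ[ℂ] K :=
    (LinearMap.fst ℂ K K + Complex.I • LinearMap.snd ℂ K K) ∘ₗ M.subtype with hp
  set q : M →ₗ[ℂ] K :=
    (LinearMap.fst ℂ K K - Complex.I • LinearMap.snd ℂ K K) ∘ₗ M.subtype with hq
  have hpq : ∀ χ, ‖q χ‖ = ‖p χ‖ := fun χ => hnorm χ χ.2
  have hpinj : Function.Injective p := by
    rw [injective_iff_map_eq_zero]
    intro χ h
    have hq0 : q χ = 0 := by rw [← norm_eq_zero, hpq, h, norm_zero]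
    have ha : χ.1.1 + Complex.I • χ.1.2 = 0 := h
    have hb : χ.1.1 - Complex.I • χ.1.2 = 0 := hq0
    have h1 : χ.1.1 = 0 := by
      have : (2 : ℂ) • χ.1.1 = 0 := by
        rw [two_smul]
        calc χ.1.1 + χ.1.1 = (χ.1.1 + Complex.I • χ.1.2) + (χ.1.1 - Complex.I • χ.1.2) := by abel
          _ = 0 := by rw [ha, hb, add_zero]
      simpa using this
    have h2 : χ.1.2 = 0 := by
      rw [h1, zero_add] at ha
      simpa using ha
    ext1
    exact Prod.ext h1 h2
  let e := LinearEquiv.ofInjective p hpinj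
  let T : LinearMap.range p →ₗᵢ[ℂ] K :=
    { toLinearMap := q ∘ₗ e.symm.toLinearMap
      norm_map' := fun x => by
        obtain ⟨χ, rfl⟩ := e.surjective x
        simp only [LinearMap.comp_apply, LinearEquiv.coe_coe, LinearEquiv.symm_apply_apply]
        exact hpq χ }
  set U : K →L[ℂ] K := T.extend.toContinuousLinearMap with hU
  have hUp : ∀ χ : M, U (p χ) = q χ := by
    intro χ
    have h1 : U (p χ) = T (e χ) := T.extend_apply (e χ)
    rw [h1]
    change q (e.symm (e χ)) = q χ
    rw [LinearEquiv.symm_apply_apply]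
  have hUU : U.adjoint ∘L U = ContinuousLinearMap.id ℂ K := by
    ext x
    refine ext_inner_left ℂ fun y => ?_
    rw [ContinuousLinearMap.comp_apply, ContinuousLinearMap.adjoint_inner_right]
    exact T.extend.inner_map_map y x
  have hUU' : ∀ x, U (U.adjoint x) = x := by
    intro x
    have hinj : Function.Injective U.toLinearMap := T.extend.injective
    obtain ⟨y, rfl⟩ := LinearMap.surjective_of_injective hinj x
    exact congrArg U (DFunLike.congr_fun hUU y)
  have hUU2 : ∀ x, U.adjoint (U x) = x := fun x => DFunLike.congr_fun hUU x
  let bc : BoundaryConditions K :=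
    { A := U - ContinuousLinearMap.id ℂ K
      B := Complex.I • (U + ContinuousLinearMap.id ℂ K)
      maximal_rank := by
        have hsurj : LinearMap.range (LinearMap.coprod
            (U - ContinuousLinearMap.id ℂ K).toLinearMap
            (Complex.I • (U + ContinuousLinearMap.id ℂ K)).toLinearMap) = ⊤ := by
          rw [LinearMap.range_eq_top]
          intro y
          refine ⟨(-(2 : ℂ)⁻¹ • y, (-(2 : ℂ)⁻¹ * Complex.I) • y), ?_⟩
          simp only [LinearMap.coprod_apply, ContinuousLinearMap.coe_coe,
            sub_apply, smul_apply,
            add_apply, ContinuousLinearMap.id_apply, map_smul, smul_add,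
            smul_smul]
          have hI : -(2 : ℂ)⁻¹ * Complex.I * Complex.I = (2 : ℂ)⁻¹ := by
            linear_combination (-(2 : ℂ)⁻¹) * Complex.I_mul_I
          rw [hI]
          module
        rw [hsurj, finrank_top]
      selfAdjoint := by
        ext x
        simp only [ContinuousLinearMap.comp_apply, map_sub, map_add, map_smulₛₗ,
          sub_apply, smul_apply,
          add_apply, ContinuousLinearMap.adjoint_id,
          ContinuousLinearMap.id_apply, Complex.conj_I, RingHom.id_apply, hUU']
        module }
  refine ⟨bc, hM.2 _ bc.isMaximalIsotropic.1 fun χ hχ => ?_⟩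
  rw [bc.mem_subspace]
  have h : U (χ.1 + Complex.I • χ.2) = χ.1 - Complex.I • χ.2 := hUp ⟨χ, hχ⟩
  rw [map_add, map_smul] at h
  change (U χ.1 - χ.1) + Complex.I • (U χ.2 + χ.2) = 0
  rw [smul_add]
  calc (U χ.1 - χ.1) + (Complex.I • U χ.2 + Complex.I • χ.2)
      = (U χ.1 + Complex.I • U χ.2) - (χ.1 - Complex.I • χ.2) := by abel
    _ = 0 := by rw [h, sub_self]

/-- The maximal isotropic subspaces of `K ⊕ K` are exactly the subspaces `M(A, B)`. -/
theorem isMaximalIsotropic_iff {M : Submodule ℂ (K × K)} :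
    IsMaximalIsotropic M ↔ ∃ bc : BoundaryConditions K, bc.subspace = M := by
  refine ⟨fun h => h.exists_boundaryConditions, ?_⟩
  rintro ⟨bc, rfl⟩
  exact bc.isMaximalIsotropic

end Symplectic

/-! ## Metric graphs and their Laplace operators -/

/-- A metric graph with vertices `V`, internal edges `I` and external edges `E`. -/
structure MetricGraph (V I E : Type*) where
  /-- the initial vertex of an internal edge -/
  initial : I → V
  /-- the terminal vertex of an internal edge -/
  terminal : I → V
  /-- the vertex of an external edge -/
  vertex : E → V
  /-- the lengths of the internal edges -/
  length : I → ℝ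
  length_pos : ∀ i, 0 < length i

/-- The finite-dimensional Hilbert space `K = K_E ⊕ K_I⁽⁻⁾ ⊕ K_I⁽⁺⁾`. -/
abbrev BoundarySpace (I E : Type*) : Type _ := EuclideanSpace ℂ (E ⊕ (I ⊕ I))

namespace MetricGraph

variable {V I E : Type*} (G : MetricGraph V I E)

/-- The interval of an edge: `[0, ∞)` for external edges, `[0, aᵢ]` for internal ones. -/
def interval : E ⊕ I → Set ℝ := Sum.elim (fun _ => Ici 0) (fun i => Icc 0 (G.length i))

theorem interval_subset_closure (j : E ⊕ I) :
    G.interval j ⊆ closure (interior (G.interval j)) := by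
  rcases j with e | i
  · simp [interval]
  · simp [interval, closure_Ioo (G.length_pos i).ne]

theorem uniqueDiffOn_interval (j : E ⊕ I) : UniqueDiffOn ℝ (G.interval j) := by
  rcases j with e | i
  · exact uniqueDiffOn_Ici 0
  · exact uniqueDiffOn_Icc (G.length_pos i)

/-- The Hilbert space `H = ⨁_j L²(I_j)`. -/
abbrev HilbertSpace : Type _ :=
  PiLp 2 (fun j : E ⊕ I => Lp ℂ 2 (volume.restrict (G.interval j)))

/-- `u ∈ L²(S)` has a representative `f` that is absolutely continuous together with its
derivative `g = f'` on (compact parts of) the interval `S ∋ 0`, and `f'' = w ∈ L²(S)`. -/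
structure IsSecondDerivative (S : Set ℝ) (u : Lp ℂ 2 (volume.restrict S)) (f g : ℝ → ℂ)
    (w : Lp ℂ 2 (volume.restrict S)) : Prop where
  ae_eq : f =ᵐ[volume.restrict S] u
  ac : ∀ b ∈ S, AbsolutelyContinuousOnInterval f 0 b
  deriv : ∀ x ∈ S, HasDerivWithinAt f (g x) S x
  ac_deriv : ∀ b ∈ S, AbsolutelyContinuousOnInterval g 0 b
  deriv_deriv : ∀ᵐ x ∂(volume.restrict S), HasDerivWithinAt g (w x) S x

/-- The boundary values `ψ̲ = ((ψ_e(0))_e, (ψ_i(0))_i, (ψ_i(a_i))_i)`. -/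
def boundaryValue (f : E ⊕ I → ℝ → ℂ) : BoundarySpace I E :=
  WithLp.toLp 2 (Sum.elim (fun e => f (.inl e) 0)
    (Sum.elim (fun i => f (.inr i) 0) (fun i => f (.inr i) (G.length i))))

/-- The boundary values `ψ̲' = ((ψ_e'(0))_e, (ψ_i'(0))_i, (-ψ_i'(a_i))_i)`,
where `g` is the derivative of `ψ`. -/
def boundaryDeriv (g : E ⊕ I → ℝ → ℂ) : BoundarySpace I E :=
  WithLp.toLp 2 (Sum.elim (fun e => g (.inl e) 0)
    (Sum.elim (fun i => g (.inr i) 0) (fun i => -g (.inr i) (G.length i))))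

variable [Fintype I] [Fintype E]

/-- The graph of the Laplace operator: all pairs `(ψ, ψ'')` with `ψ ∈ D` and `[ψ] ∈ M`. -/
def laplacianGraph (M : Submodule ℂ (BoundarySpace I E × BoundarySpace I E)) :
    Submodule ℂ (G.HilbertSpace × G.HilbertSpace) where
  carrier := {p | ∃ f g : E ⊕ I → ℝ → ℂ,
    (∀ j, IsSecondDerivative (G.interval j) (p.1 j) (f j) (g j) (p.2 j)) ∧
      (G.boundaryValue f, G.boundaryDeriv g) ∈ M}
  add_mem' := by
    rintro ⟨u, w⟩ ⟨u', w'⟩ ⟨f, g, h, hM⟩ ⟨f', g', h', hM'⟩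
    refine ⟨fun j => f j + f' j, fun j => g j + g' j, fun j => ⟨?_, ?_, ?_, ?_, ?_⟩, ?_⟩
    · filter_upwards [(h j).ae_eq, (h' j).ae_eq, Lp.coeFn_add (u j) (u' j)] with x h1 h2 h3
      simp_all
    · exact fun b hb => ((h j).ac b hb).add ((h' j).ac b hb)
    · exact fun x hx => ((h j).deriv x hx).add ((h' j).deriv x hx)
    · exact fun b hb => ((h j).ac_deriv b hb).add ((h' j).ac_deriv b hb)
    · filter_upwards [(h j).deriv_deriv, (h' j).deriv_deriv, Lp.coeFn_add (w j) (w' j)]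
        with x h1 h2 h3
      have := h1.add h2
      simp_all
    · convert M.add_mem hM hM' using 1
      refine Prod.ext ?_ ?_
      · ext (e | i | i) <;> simp [boundaryValue]
      · ext (e | i | i) <;> simp [boundaryDeriv, add_comm]
  zero_mem' := by
    refine ⟨fun _ _ => 0, fun _ _ => 0, fun j => ⟨?_, ?_, ?_, ?_, ?_⟩, ?_⟩
    · exact (Lp.coeFn_zero ℂ 2 (volume.restrict (G.interval j))).symm
    · intro b _
      exact (LipschitzWith.const (0 : ℂ)).lipschitzOnWith.absolutelyContinuousOnInterval
    · exact fun x _ => hasDerivWithinAt_const _ _ _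
    · intro b _
      exact (LipschitzWith.const (0 : ℂ)).lipschitzOnWith.absolutelyContinuousOnInterval
    · filter_upwards [Lp.coeFn_zero ℂ 2 (volume.restrict (G.interval j))] with x hx
      have : ((0 : G.HilbertSpace × G.HilbertSpace).2 j) x = 0 := hx
      rw [this]
      exact hasDerivWithinAt_const _ _ _
    · convert M.zero_mem using 1
      refine Prod.ext ?_ ?_
      · ext (e | i | i) <;> simp [boundaryValue]
      · ext (e | i | i) <;> simp [boundaryDeriv]
  smul_mem' := by
    rintro c ⟨u, w⟩ ⟨f, g, h, hM⟩
    refine ⟨fun j x => c • f j x, fun j x => c • g j x, fun j => ⟨?_, ?_, ?_, ?_, ?_⟩, ?_⟩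
    · filter_upwards [(h j).ae_eq, Lp.coeFn_smul c (u j)] with x h1 h3
      simp_all
    · exact fun b hb => ((h j).ac b hb).const_smul c
    · exact fun x hx => ((h j).deriv x hx).const_smul c
    · exact fun b hb => ((h j).ac_deriv b hb).const_smul c
    · filter_upwards [(h j).deriv_deriv, Lp.coeFn_smul c (w j)] with x h1 h3
      have h2 : ((c • (u, w) : G.HilbertSpace × G.HilbertSpace).2 j) x = c • (w j) x := h3
      rw [h2]
      exact h1.const_smul c
    · convert M.smul_mem c hM using 1
      refine Prod.ext ?_ ?_
      · ext (e | i | i) <;> simp [boundaryValue]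
      · ext (e | i | i) <;> simp [boundaryDeriv]

set_option linter.unusedSectionVars false in
/-- The second derivative is determined by the function. -/
theorem laplacianGraph_functional (M : Submodule ℂ (BoundarySpace I E × BoundarySpace I E))
    (p : G.HilbertSpace × G.HilbertSpace) (hp : p ∈ G.laplacianGraph M) (h0 : p.1 = 0) :
    p.2 = 0 := by
  obtain ⟨f, g, h, -⟩ := hp
  ext1 j
  have hu : p.1 j = 0 := by rw [h0]; rfl
  have hf0 : f j =ᵐ[volume.restrict (G.interval j)] fun _ => (0 : ℂ) := by
    filter_upwards [(h j).ae_eq, Lp.coeFn_zero ℂ 2 (volume.restrict (G.interval j))] with x h1 h2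
    rw [h1, hu, h2]
    rfl
  have hf : EqOn (f j) (fun _ => 0) (G.interval j) :=
    Measure.eqOn_of_ae_eq hf0 (fun x hx => ((h j).deriv x hx).continuousWithinAt)
      continuousOn_const (G.interval_subset_closure j)
  have hg : EqOn (g j) (fun _ => 0) (G.interval j) := fun x hx =>
    (G.uniqueDiffOn_interval j x hx).eq_deriv _ ((h j).deriv x hx)
      ((hasDerivWithinAt_const x _ (0 : ℂ)).congr hf (hf hx))
  have hmeas : MeasurableSet (G.interval j) := by
    rcases j with e | i
    · exact measurableSet_Ici
    · exact measurableSet_Icc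
  apply Lp.ext
  filter_upwards [(h j).deriv_deriv, ae_restrict_mem hmeas,
    Lp.coeFn_zero ℂ 2 (volume.restrict (G.interval j))] with x h1 hx h2
  refine Eq.trans ?_ h2.symm
  exact (G.uniqueDiffOn_interval j x hx).eq_deriv _ h1
      ((hasDerivWithinAt_const x _ (0 : ℂ)).congr hg (hg hx))

/-- The Laplace operator `Δ(M, a)`: `(Δψ)_j = ψ_j''` on the domain `{ψ ∈ D | [ψ] ∈ M}`. -/
def laplacian (M : Submodule ℂ (BoundarySpace I E × BoundarySpace I E)) :
    G.HilbertSpace →ₗ.[ℂ] G.HilbertSpace := (G.laplacianGraph M).toLinearPMap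

theorem mem_laplacian_graph {M : Submodule ℂ (BoundarySpace I E × BoundarySpace I E)}
    {p : G.HilbertSpace × G.HilbertSpace} :
    p ∈ (G.laplacian M).graph ↔ p ∈ G.laplacianGraph M := by
  rw [laplacian, Submodule.toLinearPMap_graph_eq _ (G.laplacianGraph_functional M)]

/-- The smallest length `a = min aᵢ` of the internal edges. -/
def minLength [Nonempty I] : ℝ := Finset.univ.inf' Finset.univ_nonempty G.length

end MetricGraph

/-- The operator inequality `T ≥ c` in the sense of quadratic forms: for every `ψ` in the domain
of `T`, the number `⟨ψ, T ψ⟩` is real and at least `c ‖ψ‖²`. -/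
def FormBoundedBelow {H : Type*} [NormedAddCommGroup H] [InnerProductSpace ℂ H]
    (T : H →ₗ.[ℂ] H) (c : ℝ) : Prop :=
  ∀ ψ : T.domain, (inner ℂ (ψ : H) (T ψ)).im = 0 ∧ c * ‖(ψ : H)‖ ^ 2 ≤ (inner ℂ (ψ : H) (T ψ)).re

end QuantumGraph

end

/-! Integration by parts on each edge gives `-⟨ψ, ψ''⟩ = ‖ψ'‖² + ⟨ψ̲, ψ̲'⟩`, so the boundary term
and the kinetic term can be estimated separately.

For `[ψ] ∈ M(A, B)` the boundary term equals `-⟨ψ̲, L ψ̲⟩`. It is therefore real and at least `-‖L₊‖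
‖ψ̲‖²` (`inner_eq_neg_inner_kuchment`, `neg_norm_kuchmentPos_le_re_inner`).

The kinetic term obeys the trace inequality `s tanh(as/2) ‖ψ̲‖² ≤ ‖ψ'‖² + s² ‖ψ‖²` for every `s ≥ 0`
(`exists_energy`). If `h' = s² - h²`, then `(h|f|²)' = |f'|² + s²|f|² - |f' - hf|²`, and integrating
bounds the boundary values of `h|f|²` (`riccati_le_integral`). An internal edge of length `ℓ` uses
`h(x) = s tanh(s(x - ℓ/2))`, whose end values are `∓s tanh(ℓs/2)`. An external edge uses the
constant solution `h = -s`.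

When `s tanh(as/2) = ‖L₊‖`, the two multiples of `‖ψ̲‖²` cancel and only `-s² ‖ψ‖²` is left. -/

namespace Real

/-! ### The equation `s tanh(as/2) = t`. -/

theorem tanh_strictMono : StrictMono tanh := by
  intro x y hxy
  rw [tanh_eq_sinh_div_cosh, tanh_eq_sinh_div_cosh, div_lt_div_iff₀ (cosh_pos x) (cosh_pos y)]
  -- After cross-multiplication the claim is `sinh (y - x) > 0`.
  have h := sinh_pos_iff.2 (sub_pos.2 hxy)
  rw [sinh_sub] at h
  linarith

theorem hasDerivAt_tanh (x : ℝ) : HasDerivAt tanh (1 - tanh x ^ 2) x := by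
  have h := (hasDerivAt_sinh x).div (hasDerivAt_cosh x) (cosh_pos x).ne'
  have he : tanh = sinh / cosh := funext fun y => tanh_eq_sinh_div_cosh y
  rw [he]
  refine h.congr_deriv ?_
  have := (cosh_pos x).ne'
  rw [Pi.div_apply]
  field_simp

theorem continuous_tanh : Continuous tanh :=
  continuous_iff_continuousAt.2 fun x => (hasDerivAt_tanh x).continuousAt

theorem tanh_nonneg {x : ℝ} (hx : 0 ≤ x) : 0 ≤ tanh x := by
  simpa using tanh_strictMono.monotone hx

theorem strictMonoOn_mul_tanh {a : ℝ} (ha : 0 < a) :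
    StrictMonoOn (fun s : ℝ => s * tanh (a * s / 2)) (Ici 0) := by
  intro r hr s hs hrs
  have hr0 : 0 ≤ r := hr
  have h1 : tanh (a * r / 2) < tanh (a * s / 2) := tanh_strictMono (by gcongr)
  have h2 : 0 ≤ tanh (a * r / 2) := tanh_nonneg (by positivity)
  exact mul_lt_mul'' hrs h1 hr0 h2

theorem exists_mul_tanh_eq {a t : ℝ} (ha : 0 < a) (ht : 0 ≤ t) :
    ∃ s, 0 ≤ s ∧ s * tanh (a * s / 2) = t := by
  have hc : 0 < tanh (a / 2) := by simpa using tanh_strictMono (half_pos ha)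
  -- Right end for the intermediate value theorem: `N ≥ 1` gives `tanh(aN/2) ≥ tanh(a/2)`, and `N
  -- tanh(a/2) ≥ t`.
  set N := max 1 (t / tanh (a / 2)) with hN
  have hN1 : 1 ≤ N := le_max_left _ _
  have hle : t ≤ N * tanh (a * N / 2) := calc
    t = t / tanh (a / 2) * tanh (a / 2) := by field_simp
    _ ≤ N * tanh (a * N / 2) := by
      gcongr
      · exact le_max_right _ _
      · exact tanh_strictMono.monotone (by nlinarith)
  have hcont : ContinuousOn (fun s : ℝ => s * tanh (a * s / 2)) (Icc 0 N) :=
    (continuous_id.mul (continuous_tanh.comp (by fun_prop))).continuousOn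
  obtain ⟨s, hs, h⟩ := intermediate_value_Icc (by linarith) hcont (show t ∈ Icc _ _ by simp [ht, hle])
  exact ⟨s, hs.1, h⟩

end Real

/-! ### The boundary form on `M(A, B)`. -/

namespace QuantumGraph

namespace BoundaryConditions

variable {K : Type*} [NormedAddCommGroup K] [InnerProductSpace ℂ K] [FiniteDimensional ℂ K]

/-- On `M(A, B)` the component `χ₁` lies in `Ran B† = (Ker B)^⊥`, so `B L χ₁ = A χ₁`. Hence `B (L χ₁
+ χ₂) = 0`, and `L χ₁ + χ₂ ∈ Ker B` is orthogonal to `χ₁`. -/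
theorem inner_eq_neg_inner_kuchment (bc : BoundaryConditions K) {χ : K × K}
    (h : χ ∈ bc.subspace) : inner ℂ χ.1 χ.2 = -inner ℂ χ.1 (bc.kuchment χ.1) := by
  have hmem : χ.1 ∈ (LinearMap.ker bc.B.toLinearMap)ᗮ := by
    obtain ⟨x, rfl⟩ := bc.mem_subspace_iff_exists.1 h
    rw [bc.ker_orthogonal]
    exact ⟨-x, by simp⟩
  have hker : bc.kuchment χ.1 + χ.2 ∈ LinearMap.ker bc.B.toLinearMap := by
    have hB := bc.B_kuchment χ.1
    rw [Submodule.starProjection_eq_self_iff.2 hmem] at hB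
    rw [LinearMap.mem_ker, ContinuousLinearMap.coe_coe, map_add, hB]
    exact bc.mem_subspace.1 h
  have h0 := Submodule.inner_left_of_mem_orthogonal hker hmem
  rw [inner_add_right] at h0
  linear_combination h0

theorem inner_im_eq_zero (bc : BoundaryConditions K) {χ : K × K} (h : χ ∈ bc.subspace) :
    (inner ℂ χ.1 χ.2).im = 0 := by
  have hs := (ContinuousLinearMap.isSelfAdjoint_iff_isSymmetric.1 bc.kuchment_isSelfAdjoint)
  have := hs.im_inner_self_apply χ.1
  rw [bc.inner_eq_neg_inner_kuchment h, Complex.neg_im, neg_eq_zero]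
  exact this

/-- Combines `L ≤ L₊` with Cauchy–Schwarz for `L₊`. -/
theorem neg_norm_kuchmentPos_le_re_inner (bc : BoundaryConditions K) {χ : K × K}
    (h : χ ∈ bc.subspace) : -(‖bc.kuchmentPos‖ * ‖χ.1‖ ^ 2) ≤ (inner ℂ χ.1 χ.2).re := by
  have hle : bc.kuchment ≤ bc.kuchmentPos := CFC.le_posPart bc.kuchment_isSelfAdjoint
  have h1 := ((ContinuousLinearMap.le_def _ _).1 hle).re_inner_nonneg_right χ.1
  rw [sub_apply, inner_sub_right, map_sub, sub_nonneg] at h1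
  have h2 : RCLike.re (inner ℂ χ.1 (bc.kuchmentPos χ.1)) ≤ ‖bc.kuchmentPos‖ * ‖χ.1‖ ^ 2 := calc
    _ ≤ ‖χ.1‖ * ‖bc.kuchmentPos χ.1‖ := re_inner_le_norm _ _
    _ ≤ ‖χ.1‖ * (‖bc.kuchmentPos‖ * ‖χ.1‖) := by gcongr; exact bc.kuchmentPos.le_opNorm _
    _ = _ := by ring
  rw [bc.inner_eq_neg_inner_kuchment h, Complex.neg_re]
  exact neg_le_neg (h1.trans h2)

end BoundaryConditions

end QuantumGraph

/-! ### The fundamental theorem of calculus for absolutely continuous functions. -/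

theorem LipschitzWith.comp_absolutelyContinuousOnInterval {X Y : Type*} [PseudoMetricSpace X]
    [PseudoMetricSpace Y] {φ : X → Y} {C : NNReal} (hφ : LipschitzWith C φ) {f : ℝ → X} {a b : ℝ}
    (hf : AbsolutelyContinuousOnInterval f a b) :
    AbsolutelyContinuousOnInterval (fun x => φ (f x)) a b := by
  have h := Filter.Tendsto.const_mul (C : ℝ) hf
  rw [mul_zero] at h
  refine squeeze_zero (fun _ => Finset.sum_nonneg fun _ _ => dist_nonneg) (fun E => ?_) h
  rw [Finset.mul_sum]
  exact Finset.sum_le_sum fun i _ => hφ.dist_le_mul _ _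

theorem AbsolutelyContinuousOnInterval.integral_eq_sub {F : ℝ → ℝ} {w : ℝ → ℝ} {a b : ℝ}
    (hab : a ≤ b) (hF : AbsolutelyContinuousOnInterval F a b)
    (hd : ∀ᵐ x, x ∈ Ioo a b → HasDerivAt F (w x) x) : ∫ x in a..b, w x = F b - F a := by
  rw [← hF.integral_deriv_eq_sub]
  refine intervalIntegral.integral_congr_ae ?_
  -- The integral runs over `(a, b]`, while `hd` covers only the open interval; the point `b` is
  -- discarded as a null set.
  filter_upwards [hd, compl_mem_ae_iff.2 (measure_singleton (μ := volume) b)] with x hx hxb hmem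
  rw [uIoc_of_le hab] at hmem
  exact (hx ⟨hmem.1, lt_of_le_of_ne hmem.2 hxb⟩).deriv.symm

/-- The real case is applied to real and imaginary parts; `hw` lets these commute with the integral.
-/
theorem AbsolutelyContinuousOnInterval.integral_eq_sub_complex {F : ℝ → ℂ} {w : ℝ → ℂ} {a b : ℝ}
    (hab : a ≤ b) (hF : AbsolutelyContinuousOnInterval F a b)
    (hw : IntervalIntegrable w volume a b)
    (hd : ∀ᵐ x, x ∈ Ioo a b → HasDerivAt F (w x) x) : ∫ x in a..b, w x = F b - F a := by
  have hre : ∫ x in a..b, (w x).re = (F b).re - (F a).re :=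
    integral_eq_sub hab (Complex.reCLM.lipschitz.comp_absolutelyContinuousOnInterval hF) (by
      filter_upwards [hd] with x hx hmem
      exact Complex.reCLM.hasFDerivAt.comp_hasDerivAt x (hx hmem))
  have him : ∫ x in a..b, (w x).im = (F b).im - (F a).im :=
    integral_eq_sub hab (Complex.imCLM.lipschitz.comp_absolutelyContinuousOnInterval hF) (by
      filter_upwards [hd] with x hx hmem
      exact Complex.imCLM.hasFDerivAt.comp_hasDerivAt x (hx hmem))
  have h1 := Complex.reCLM.intervalIntegral_comp_comm hw
  have h2 := Complex.imCLM.intervalIntegral_comp_comm hw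
  simp only [Complex.reCLM_apply, Complex.imCLM_apply] at h1 h2
  exact Complex.ext (by rw [← h1, hre, Complex.sub_re]) (by rw [← h2, him, Complex.sub_im])

theorem AbsolutelyContinuousOnInterval.complex_inner {f g : ℝ → ℂ} {a b : ℝ}
    (hf : AbsolutelyContinuousOnInterval f a b) (hg : AbsolutelyContinuousOnInterval g a b) :
    AbsolutelyContinuousOnInterval (fun x => inner ℂ (f x) (g x)) a b := by
  have h := (Complex.conjCLE.lipschitz.comp_absolutelyContinuousOnInterval hf).fun_smul hg
  have he : (fun x => inner ℂ (f x) (g x)) = fun x => Complex.conjCLE (f x) • g x :=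
    funext fun x => by simp [RCLike.inner_apply, mul_comm]
  rwa [he]

/-! ### Riccati estimate and behaviour at infinity. -/

/-- Completing the square with a solution `h` of the Riccati equation `h' = s ^ 2 - h ^ 2`. -/
theorem riccati_le_integral {f g : ℝ → ℂ} {h : ℝ → ℝ} {s b : ℝ} (hb : 0 ≤ b)
    (hf : ContinuousOn f (Icc 0 b)) (hg : ContinuousOn g (Icc 0 b))
    (hd : ∀ x ∈ Ioo 0 b, HasDerivAt f (g x) x)
    (hh : ∀ x, HasDerivAt h (s ^ 2 - h x ^ 2) x) :
    h b * ‖f b‖ ^ 2 - h 0 * ‖f 0‖ ^ 2 ≤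
      (∫ x in (0 : ℝ)..b, ‖g x‖ ^ 2) + s ^ 2 * ∫ x in (0 : ℝ)..b, ‖f x‖ ^ 2 := by
  have hhc : Continuous h := continuous_iff_continuousAt.2 fun x => (hh x).continuousAt
  have hhf : ContinuousOn (fun x => ((h x : ℂ)) * f x) (Icc 0 b) :=
    (Complex.continuous_ofReal.comp hhc).continuousOn.mul hf
  have hg2 : IntervalIntegrable (fun x => ‖g x‖ ^ 2) volume 0 b :=
    (hg.norm.pow 2).intervalIntegrable_of_Icc hb
  have hf2 : IntervalIntegrable (fun x => ‖f x‖ ^ 2) volume 0 b :=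
    (hf.norm.pow 2).intervalIntegrable_of_Icc hb
  have hs2 : IntervalIntegrable (fun x => ‖g x - h x * f x‖ ^ 2) volume 0 b :=
    ((hg.sub hhf).norm.pow 2).intervalIntegrable_of_Icc hb
  have hint := ((hg2.add (hf2.const_mul (s ^ 2))).sub hs2)
  -- By the Riccati equation, `(h|f|²)' = |g|² + s²|f|² - |g - hf|²`; the last square is dropped at
  -- the end.
  have hftc := intervalIntegral.integral_eq_sub_of_hasDerivAt_of_le hb
    (f := fun x => h x * ‖f x‖ ^ 2) (hhc.continuousOn.mul (hf.norm.pow 2)) (fun x hx => by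
      refine ((hh x).mul (hd x hx).norm_sq).congr_deriv ?_
      simp only [Complex.inner, ← Complex.normSq_eq_norm_sq, Complex.normSq_apply, Complex.sub_re,
        Complex.sub_im, Complex.mul_re, Complex.mul_im, Complex.ofReal_re, Complex.ofReal_im,
        Complex.conj_re, Complex.conj_im]
      ring) hint
  rw [← hftc, intervalIntegral.integral_sub (hg2.add (hf2.const_mul _)) hs2,
    intervalIntegral.integral_add hg2 (hf2.const_mul _), intervalIntegral.integral_const_mul]
  linarith [intervalIntegral.integral_nonneg hb (f := fun x => ‖g x - h x * f x‖ ^ 2)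
    (μ := volume) fun x _ => by positivity]

theorem hasDerivAt_mul_tanh_riccati (s c x : ℝ) :
    HasDerivAt (fun x => s * Real.tanh (s * (x - c)))
      (s ^ 2 - (s * Real.tanh (s * (x - c))) ^ 2) x := by
  have h1 : HasDerivAt (fun x => s * (x - c)) s x := by
    simpa using ((hasDerivAt_id x).sub_const c).const_mul s
  refine (((Real.hasDerivAt_tanh _).comp x h1).const_mul s).congr_deriv ?_
  ring

theorem hasDerivAt_norm_sq_complex {f g : ℝ → ℂ} {x : ℝ} (hd : HasDerivAt f (g x) x) :
    HasDerivAt (fun x => ‖f x‖ ^ 2) (2 * (inner ℂ (f x) (g x)).re) x := by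
  refine hd.norm_sq.congr_deriv ?_
  simp [Complex.inner, mul_comm]

/-- If `f` and `f''` are square integrable on a half line, then so is `f'`. -/
theorem integrableOn_Ioi_norm_sq_deriv {f g : ℝ → ℂ} {p : ℝ → ℂ}
    (hf : ContinuousOn f (Ici 0)) (hg : ContinuousOn g (Ici 0))
    (hd : ∀ x ∈ Ioi (0 : ℝ), HasDerivAt f (g x) x)
    (hf2 : IntegrableOn (fun x => ‖f x‖ ^ 2) (Ioi 0)) (hp : IntegrableOn p (Ioi 0))
    (hQ : ∀ b, 0 ≤ b → (∫ x in (0 : ℝ)..b, ((‖g x‖ ^ 2 : ℝ) : ℂ)) + ∫ x in (0 : ℝ)..b, p x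
      = inner ℂ (f b) (g b) - inner ℂ (f 0) (g 0)) :
    IntegrableOn (fun x => ‖g x‖ ^ 2) (Ioi 0) := by
  -- Otherwise `(|f|²)' = 2 Re⟨f, g⟩ > 2` beyond `N`, so `|f|² ≥ 1` beyond `N + 1`, contradicting
  -- integrability.
  have hfreq : ∀ N : ℝ, 0 ≤ N → ∃ b, N ≤ b ∧ (inner ℂ (f b) (g b)).re ≤ 1 := by
    intro N hN
    by_contra! hcon
    have hgrow : ∀ x ∈ Ioi (N + 1), (1 : ℝ) ≤ ‖f x‖ ^ 2 := by
      intro x hx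
      have hx' : N + 1 < x := hx
      have := (convex_Icc N x).mul_sub_le_image_sub_of_le_deriv (f := fun x => ‖f x‖ ^ 2) (C := 2)
        ((hf.mono fun y hy => hN.trans hy.1).norm.pow 2) (fun y hy => by
          rw [interior_Icc] at hy
          exact (hasDerivAt_norm_sq_complex
            (hd y (hN.trans_lt hy.1))).differentiableAt.differentiableWithinAt)
        (fun y hy => by
          rw [interior_Icc] at hy
          rw [(hasDerivAt_norm_sq_complex (hd y (hN.trans_lt hy.1))).deriv]
          linarith [hcon y hy.1.le]) N ⟨le_rfl, by linarith⟩ x ⟨by linarith, le_rfl⟩ (by linarith)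
      have h0 : 0 ≤ ‖f N‖ ^ 2 := by positivity
      linarith
    have h1 : IntegrableOn (fun _ => (1 : ℝ)) (Ioi (N + 1)) := by
      refine Integrable.mono' (hf2.mono_set (Ioi_subset_Ioi (by linarith)))
        aestronglyMeasurable_const ?_
      filter_upwards [ae_restrict_mem measurableSet_Ioi] with x hx
      simpa using hgrow x hx
    rw [integrableOn_const_iff] at h1
    simp at h1
  have hgint : ∀ b : ℝ, 0 ≤ b → IntervalIntegrable (fun x => ‖g x‖ ^ 2) volume 0 b := fun b hb =>
    ((hg.mono fun y hy => hy.1).norm.pow 2).intervalIntegrable_of_Icc hb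
  -- The bound that `hQ` gives for `∫₀ᵇ |g|²` at a point `b` from `hfreq`. Such `b` exist beyond
  -- every `n`, so monotonicity in the upper limit bounds every `∫₀ⁿ |g|²`.
  set C := 1 - (inner ℂ (f 0) (g 0)).re + ∫ x in Ioi (0 : ℝ), ‖p x‖ with hC
  refine integrableOn_Ioi_of_intervalIntegral_norm_bounded C 0 (l := Filter.atTop)
    (b := fun n : ℕ => (n : ℝ)) (fun n => ?_) tendsto_natCast_atTop_atTop
    (Filter.Eventually.of_forall fun n => ?_)
  · exact (intervalIntegrable_iff_integrableOn_Ioc_of_le n.cast_nonneg).1 (hgint n n.cast_nonneg)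
  · obtain ⟨b, hnb, hb⟩ := hfreq n n.cast_nonneg
    have hb0 : (0 : ℝ) ≤ b := n.cast_nonneg.trans hnb
    have h1 := congrArg Complex.re (hQ b hb0)
    rw [Complex.add_re, intervalIntegral.integral_ofReal, Complex.ofReal_re, Complex.sub_re] at h1
    have h2 : ∫ x in (0 : ℝ)..n, ‖g x‖ ^ 2 ≤ ∫ x in (0 : ℝ)..b, ‖g x‖ ^ 2 :=
      intervalIntegral.integral_mono_interval le_rfl n.cast_nonneg hnb
        (Filter.Eventually.of_forall fun x => by positivity) (hgint b hb0)
    have h3 : -(∫ x in (0 : ℝ)..b, p x).re ≤ ∫ x in Ioi (0 : ℝ), ‖p x‖ := calc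
      _ ≤ ‖∫ x in (0 : ℝ)..b, p x‖ := (neg_le_abs _).trans (Complex.abs_re_le_norm _)
      _ ≤ ∫ x in (0 : ℝ)..b, ‖p x‖ := intervalIntegral.norm_integral_le_integral_norm hb0
      _ ≤ _ := by
        rw [intervalIntegral.integral_of_le hb0]
        exact setIntegral_mono_set hp.norm (Filter.Eventually.of_forall fun x => norm_nonneg _)
          (Ioc_subset_Ioi_self.eventuallyLE)
    simp only [norm_pow, norm_norm]
    linarith

/-- Every neighbourhood of `+∞` has infinite measure, so an integrable function cannot have a
nonzero limit there. -/
theorem eq_zero_of_tendsto_of_integrableOn_Ioi {F : ℝ → ℂ} {c : ℂ} {a : ℝ}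
    (hF : IntegrableOn F (Ioi a)) (h : Filter.Tendsto F Filter.atTop (nhds c)) : c = 0 := by
  refine IntegrableAtFilter.eq_zero_of_tendsto (μ := volume) (l := Filter.atTop)
    ⟨Ioi a, Filter.Ioi_mem_atTop a, hF⟩ (fun s hs => ?_) h
  obtain ⟨b, hb⟩ := Filter.mem_atTop_sets.1 hs
  exact top_unique (by rw [← Real.volume_Ici (a := b)]; exact measure_mono hb)

/-! ### Energy identity and trace inequality on a single edge. -/

namespace QuantumGraph

namespace MetricGraph

namespace IsSecondDerivative

variable {S : Set ℝ} {u w : Lp ℂ 2 (volume.restrict S)} {f g : ℝ → ℂ}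

theorem inner_eq_setIntegral (h : IsSecondDerivative S u f g w) :
    inner ℂ u w = ∫ x in S, inner ℂ (f x) (w x) := by
  rw [L2.inner_def]
  refine integral_congr_ae ?_
  filter_upwards [h.ae_eq] with x hx
  rw [hx]

theorem integrableOn_inner (h : IsSecondDerivative S u f g w) :
    IntegrableOn (fun x => (inner ℂ (f x) (w x) : ℂ)) S := by
  refine (L2.integrable_inner (𝕜 := ℂ) u w).congr ?_
  filter_upwards [h.ae_eq] with x hx
  rw [hx]

theorem norm_sq_eq_setIntegral (h : IsSecondDerivative S u f g w) :
    ‖u‖ ^ 2 = ∫ x in S, ‖f x‖ ^ 2 := by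
  have h1 : ((‖u‖ ^ 2 : ℝ) : ℂ) = ((∫ x in S, ‖f x‖ ^ 2 : ℝ) : ℂ) := by
    rw [← integral_complex_ofReal, Complex.ofReal_pow]
    refine (inner_self_eq_norm_sq_to_K (𝕜 := ℂ) u).symm.trans ?_
    rw [L2.inner_def]
    refine integral_congr_ae ?_
    filter_upwards [h.ae_eq] with x hx
    rw [hx, Complex.ofReal_pow]
    exact inner_self_eq_norm_sq_to_K _
  exact_mod_cast h1

theorem integrableOn_norm_sq (h : IsSecondDerivative S u f g w) :
    IntegrableOn (fun x => ‖f x‖ ^ 2) S := by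
  refine ((memLp_two_iff_integrable_sq_norm (Lp.aestronglyMeasurable u)).1 (Lp.memLp u)).congr ?_
  filter_upwards [h.ae_eq] with x hx
  rw [hx]

theorem continuousOn (h : IsSecondDerivative S u f g w) : ContinuousOn f S := fun x hx =>
  (h.deriv x hx).continuousWithinAt

theorem continuousOn_deriv (h : IsSecondDerivative S u f g w) {b : ℝ} (hb : 0 ≤ b) (hbS : b ∈ S) :
    ContinuousOn g (Icc 0 b) := by
  simpa [uIcc_of_le hb] using (h.ac_deriv b hbS).continuousOn

theorem hasDerivAt (h : IsSecondDerivative S u f g w) {b : ℝ} (hS : Icc 0 b ⊆ S) {x : ℝ}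
    (hx : x ∈ Ioo 0 b) : HasDerivAt f (g x) x :=
  (h.deriv x (hS (Ioo_subset_Icc_self hx))).hasDerivAt
    (Filter.mem_of_superset (Icc_mem_nhds hx.1 hx.2) hS)

/-- Integration by parts for `⟨ψ, ψ''⟩`. -/
theorem integral_norm_sq_deriv_add (h : IsSecondDerivative S u f g w) {b : ℝ} (hb : 0 ≤ b)
    (hS : Icc 0 b ⊆ S) :
    (∫ x in (0 : ℝ)..b, ((‖g x‖ ^ 2 : ℝ) : ℂ)) + ∫ x in (0 : ℝ)..b, inner ℂ (f x) (w x)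
      = inner ℂ (f b) (g b) - inner ℂ (f 0) (g 0) := by
  have hbS : b ∈ S := hS ⟨hb, le_rfl⟩
  have hg2 : IntervalIntegrable (fun x => ((‖g x‖ ^ 2 : ℝ) : ℂ)) volume 0 b :=
    (Complex.continuous_ofReal.comp_continuousOn
      ((h.continuousOn_deriv hb hbS).norm.pow 2)).intervalIntegrable_of_Icc hb
  have hp : IntervalIntegrable (fun x => (inner ℂ (f x) (w x) : ℂ)) volume 0 b :=
    (intervalIntegrable_iff_integrableOn_Ioc_of_le hb).2
      (h.integrableOn_inner.mono_set (Ioc_subset_Icc_self.trans hS))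
  rw [← intervalIntegral.integral_add hg2 hp]
  refine ((h.ac b hbS).complex_inner (h.ac_deriv b hbS)).integral_eq_sub_complex hb
    (hg2.add hp) ?_
  have hd := ae_restrict_of_ae_restrict_of_subset (Ioo_subset_Icc_self.trans hS) h.deriv_deriv
  rw [ae_restrict_iff' measurableSet_Ioo] at hd
  filter_upwards [hd] with x hx hmem
  have hgx : HasDerivAt g (w x) x :=
    (hx hmem).hasDerivAt (Filter.mem_of_superset (Icc_mem_nhds hmem.1 hmem.2) hS)
  refine ((h.hasDerivAt hS hmem).inner ℂ hgx).congr_deriv ?_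
  rw [inner_self_eq_norm_sq_to_K, add_comm, Complex.ofReal_pow]
  rfl

/-- Here `D = ∫ |f'|²`. Centring the Riccati solution at `a / 2` makes it odd about the midpoint, so
both endpoints receive the same weight. -/
theorem exists_energy_Icc {a : ℝ} (ha : 0 < a) {u w : Lp ℂ 2 (volume.restrict (Icc 0 a))}
    (h : IsSecondDerivative (Icc 0 a) u f g w) :
    ∃ D : ℝ, inner ℂ u w = -(D : ℂ) - (inner ℂ (f 0) (g 0) + inner ℂ (f a) (-g a)) ∧
      ∀ s : ℝ, s * Real.tanh (a * s / 2) * (‖f 0‖ ^ 2 + ‖f a‖ ^ 2) ≤ D + s ^ 2 * ‖u‖ ^ 2 := by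
  refine ⟨∫ x in (0 : ℝ)..a, ‖g x‖ ^ 2, ?_, fun s => ?_⟩
  · have h1 := h.integral_norm_sq_deriv_add ha.le Subset.rfl
    rw [h.inner_eq_setIntegral, integral_Icc_eq_integral_Ioc, ← intervalIntegral.integral_of_le ha.le,
      ← intervalIntegral.integral_ofReal, inner_neg_right]
    linear_combination h1
  · have h1 := riccati_le_integral ha.le h.continuousOn (h.continuousOn_deriv ha.le ⟨ha.le, le_rfl⟩)
      (fun x hx => h.hasDerivAt Subset.rfl hx) (hasDerivAt_mul_tanh_riccati s (a / 2))
    rw [h.norm_sq_eq_setIntegral, integral_Icc_eq_integral_Ioc,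
      ← intervalIntegral.integral_of_le ha.le]
    have e1 : s * (a - a / 2) = a * s / 2 := by ring
    have e2 : s * (0 - a / 2) = -(a * s / 2) := by ring
    rw [e1, e2, Real.tanh_neg] at h1
    linarith

/-- Again `D = ∫ |f'|²`, finite by `integrableOn_Ioi_norm_sq_deriv`. Both claims are limits of
statements on `[0, b]`, and the work lies in showing that the terms at `b` vanish. -/
theorem exists_energy_Ici {u w : Lp ℂ 2 (volume.restrict (Ici (0 : ℝ)))}
    (h : IsSecondDerivative (Ici 0) u f g w) :
    ∃ D : ℝ, inner ℂ u w = -(D : ℂ) - inner ℂ (f 0) (g 0) ∧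
      ∀ s : ℝ, s * ‖f 0‖ ^ 2 ≤ D + s ^ 2 * ‖u‖ ^ 2 := by
  have hS : ∀ b : ℝ, Icc 0 b ⊆ Ici 0 := fun b => Icc_subset_Ici_self
  have hd : ∀ x ∈ Ioi (0 : ℝ), HasDerivAt f (g x) x := fun x hx =>
    h.hasDerivAt (hS (x + 1)) ⟨hx, by linarith⟩
  -- Continuity at `x` is taken from `[0, x + 1]`, a neighbourhood of `x` within the half line.
  have hgc : ContinuousOn g (Ici 0) := fun x hx =>
    ((h.continuousOn_deriv (b := x + 1) (by linarith [mem_Ici.1 hx])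
      (by simpa using by linarith [mem_Ici.1 hx])) x ⟨hx, by linarith⟩).mono_of_mem_nhdsWithin
        (by rw [← Ici_inter_Iic]; exact inter_mem_nhdsWithin _ (Iic_mem_nhds (by linarith)))
  have hf2 := h.integrableOn_norm_sq.mono_set Ioi_subset_Ici_self
  have hp := h.integrableOn_inner.mono_set Ioi_subset_Ici_self
  have hQ := fun (b : ℝ) (hb : 0 ≤ b) => h.integral_norm_sq_deriv_add hb (hS b)
  have hg2 := integrableOn_Ioi_norm_sq_deriv h.continuousOn hgc hd hf2 hp hQ
  have hQint : IntegrableOn (fun x => (inner ℂ (f x) (g x) : ℂ)) (Ioi 0) := by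
    refine Integrable.mono' (hf2.add hg2) ?_ (Filter.Eventually.of_forall fun x => ?_)
    · exact ((h.continuousOn.inner hgc).mono Ioi_subset_Ici_self).aestronglyMeasurable
        measurableSet_Ioi
    · refine (norm_inner_le_norm _ _).trans ?_
      simp only [Pi.add_apply]
      nlinarith [sq_nonneg (‖f x‖ - ‖g x‖), sq_nonneg ‖f x‖, sq_nonneg ‖g x‖]
  have hlim_g : Filter.Tendsto (fun b : ℝ => ∫ x in (0 : ℝ)..b, ‖g x‖ ^ 2) Filter.atTop
      (nhds (∫ x in Ioi (0 : ℝ), ‖g x‖ ^ 2)) :=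
    intervalIntegral_tendsto_integral_Ioi 0 hg2 Filter.tendsto_id
  have hlim_f : Filter.Tendsto (fun b : ℝ => ∫ x in (0 : ℝ)..b, ‖f x‖ ^ 2) Filter.atTop
      (nhds (∫ x in Ioi (0 : ℝ), ‖f x‖ ^ 2)) :=
    intervalIntegral_tendsto_integral_Ioi 0 hf2 Filter.tendsto_id
  have hlim_p := intervalIntegral_tendsto_integral_Ioi 0 hp Filter.tendsto_id
  refine ⟨∫ x in Ioi (0 : ℝ), ‖g x‖ ^ 2, ?_, fun s => ?_⟩
  -- Integration by parts shows that `⟨f, g⟩` has a limit at infinity; being integrable, it must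
  -- tend to `0`.
  · have hlim : Filter.Tendsto (fun x => (inner ℂ (f x) (g x) : ℂ)) Filter.atTop
        (nhds (((∫ x in Ioi (0 : ℝ), ‖g x‖ ^ 2 : ℝ) : ℂ)
          + (∫ x in Ioi (0 : ℝ), inner ℂ (f x) (w x)) + inner ℂ (f 0) (g 0))) := by
      refine ((((Complex.continuous_ofReal.tendsto _).comp hlim_g).add hlim_p).add_const _).congr' ?_
      filter_upwards [Filter.eventually_ge_atTop 0] with b hb
      have h1 := hQ b hb
      rw [intervalIntegral.integral_ofReal] at h1
      simp only [Function.comp_apply, id]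
      linear_combination h1
    have h0 := eq_zero_of_tendsto_of_integrableOn_Ioi hQint hlim
    rw [h.inner_eq_setIntegral, integral_Ici_eq_integral_Ioi]
    linear_combination h0
  -- `|f|²` and its derivative `2 Re⟨f, g⟩` are both integrable.
  · have hf0 : Filter.Tendsto (fun x => ‖f x‖ ^ 2) Filter.atTop (nhds 0) :=
      tendsto_zero_of_hasDerivAt_of_integrableOn_Ioi
        (fun x hx => hasDerivAt_norm_sq_complex (hd x hx)) (hQint.re.const_mul 2) hf2
    have hlim := hlim_g.add (hlim_f.const_mul (s ^ 2))
    have hlim' := (hf0.const_mul (-s)).sub_const (-s * ‖f 0‖ ^ 2)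
    rw [h.norm_sq_eq_setIntegral, integral_Ici_eq_integral_Ioi]
    have := le_of_tendsto_of_tendsto hlim' hlim (by
      filter_upwards [Filter.eventually_ge_atTop 0] with b hb
      -- For constant `h = -s` both sides of the Riccati equation are `0`.
      exact riccati_le_integral (h := fun _ => -s) hb (h.continuousOn.mono (hS b))
        (hgc.mono (hS b)) (fun x hx => hd x hx.1) (fun x => by
          convert! hasDerivAt_const x (-s) using 1
          ring))
    linarith

end IsSecondDerivative

end MetricGraph

end QuantumGraph

/-! ### Summation over the edges and the form bound. -/

namespace QuantumGraph

namespace MetricGraph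

variable {V I E : Type*} (G : MetricGraph V I E)

theorem inner_boundaryValue_boundaryDeriv [Fintype I] [Fintype E] (f g : E ⊕ I → ℝ → ℂ) :
    inner ℂ (G.boundaryValue f) (G.boundaryDeriv g) =
      (∑ e, inner ℂ (f (.inl e) 0) (g (.inl e) 0)) +
        ∑ i, (inner ℂ (f (.inr i) 0) (g (.inr i) 0) +
          inner ℂ (f (.inr i) (G.length i)) (-g (.inr i) (G.length i))) := by
  simp only [PiLp.inner_apply, Fintype.sum_sum_type, boundaryValue, boundaryDeriv, Sum.elim_inl,
    Sum.elim_inr, Finset.sum_add_distrib]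

theorem norm_sq_boundaryValue [Fintype I] [Fintype E] (f : E ⊕ I → ℝ → ℂ) :
    ‖G.boundaryValue f‖ ^ 2 = (∑ e, ‖f (.inl e) 0‖ ^ 2) +
      ∑ i, (‖f (.inr i) 0‖ ^ 2 + ‖f (.inr i) (G.length i)‖ ^ 2) := by
  simp only [EuclideanSpace.norm_sq_eq, Fintype.sum_sum_type, boundaryValue, Sum.elim_inl,
    Sum.elim_inr, Finset.sum_add_distrib]

theorem minLength_pos [Fintype I] [Nonempty I] : 0 < G.minLength :=
  (Finset.lt_inf'_iff _).2 fun i _ => G.length_pos i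

theorem minLength_le [Fintype I] [Nonempty I] (i : I) : G.minLength ≤ G.length i :=
  Finset.inf'_le _ (Finset.mem_univ i)

/-- The quadratic form of the Laplace operator is `‖ψ'‖² + ⟨ψ̲, ψ̲'⟩` up to sign, and the energy
`D = ‖ψ'‖²` controls the boundary values. -/
theorem exists_energy [Fintype I] [Fintype E] [Nonempty I] {u w : G.HilbertSpace}
    {f g : E ⊕ I → ℝ → ℂ} (h : ∀ j, IsSecondDerivative (G.interval j) (u j) (f j) (g j) (w j)) :
    ∃ D : ℝ, inner ℂ u w = -(D : ℂ) - inner ℂ (G.boundaryValue f) (G.boundaryDeriv g) ∧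
      ∀ s : ℝ, 0 ≤ s → s * Real.tanh (G.minLength * s / 2) * ‖G.boundaryValue f‖ ^ 2 ≤
        D + s ^ 2 * ‖u‖ ^ 2 := by
  have hE : ∀ e, ∃ D : ℝ, inner ℂ (u (.inl e)) (w (.inl e)) =
      -(D : ℂ) - inner ℂ (f (.inl e) 0) (g (.inl e) 0) ∧
      ∀ s : ℝ, s * ‖f (.inl e) 0‖ ^ 2 ≤ D + s ^ 2 * ‖u (.inl e)‖ ^ 2 := fun e =>
    IsSecondDerivative.exists_energy_Ici (h (.inl e))
  have hI : ∀ i, ∃ D : ℝ, inner ℂ (u (.inr i)) (w (.inr i)) =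
      -(D : ℂ) - (inner ℂ (f (.inr i) 0) (g (.inr i) 0) +
        inner ℂ (f (.inr i) (G.length i)) (-g (.inr i) (G.length i))) ∧
      ∀ s : ℝ, s * Real.tanh (G.length i * s / 2) *
        (‖f (.inr i) 0‖ ^ 2 + ‖f (.inr i) (G.length i)‖ ^ 2) ≤ D + s ^ 2 * ‖u (.inr i)‖ ^ 2 :=
    fun i => IsSecondDerivative.exists_energy_Icc (G.length_pos i) (h (.inr i))
  choose DE hE1 hE2 using hE
  choose DI hI1 hI2 using hI
  refine ⟨∑ e, DE e + ∑ i, DI i, ?_, fun s hs => ?_⟩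
  · rw [PiLp.inner_apply, Fintype.sum_sum_type, inner_boundaryValue_boundaryDeriv,
      Finset.sum_congr rfl fun e _ => hE1 e, Finset.sum_congr rfl fun i _ => hI1 i]
    simp only [Finset.sum_sub_distrib, Finset.sum_neg_distrib, Complex.ofReal_add,
      Complex.ofReal_sum]
    ring
  -- All edges get the common weight `s tanh(as/2)`: external edges allow the larger `s` because
  -- `tanh < 1`, internal ones allow `s tanh(aᵢs/2)` with `aᵢ ≥ a`.
  · have hE3 : ∀ e, s * Real.tanh (G.minLength * s / 2) * ‖f (.inl e) 0‖ ^ 2 ≤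
        DE e + s ^ 2 * ‖u (.inl e)‖ ^ 2 := fun e => by
      refine le_trans ?_ (hE2 e s)
      gcongr
      exact mul_le_of_le_one_right hs (Real.tanh_lt_one _).le
    have hI3 : ∀ i, s * Real.tanh (G.minLength * s / 2) *
        (‖f (.inr i) 0‖ ^ 2 + ‖f (.inr i) (G.length i)‖ ^ 2) ≤
        DI i + s ^ 2 * ‖u (.inr i)‖ ^ 2 := fun i => by
      refine le_trans ?_ (hI2 i s)
      gcongr
      refine Real.tanh_strictMono.monotone ?_
      gcongr
      exact G.minLength_le i
    have h1 := add_le_add (Finset.sum_le_sum fun e (_ : e ∈ Finset.univ) => hE3 e)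
      (Finset.sum_le_sum fun i (_ : i ∈ Finset.univ) => hI3 i)
    rw [norm_sq_boundaryValue, PiLp.norm_sq_eq_of_L2, Fintype.sum_sum_type]
    simp only [Finset.sum_add_distrib, ← Finset.mul_sum] at h1 ⊢
    linarith

end MetricGraph

end QuantumGraph

theorem mainTheorem2 {V I E : Type*} [Fintype I] [Fintype E] [Nonempty I]
    (G : QuantumGraph.MetricGraph V I E) :
    ∃ s : ℝ → ℝ,
      (∀ t : ℝ, 0 ≤ t →
        (0 ≤ s t ∧ s t * Real.tanh (G.minLength * s t / 2) = t) ∧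
        ∀ r : ℝ, 0 ≤ r → r * Real.tanh (G.minLength * r / 2) = t → r = s t) ∧
      ∀ M : Submodule ℂ (QuantumGraph.BoundarySpace I E × QuantumGraph.BoundarySpace I E),
        QuantumGraph.IsMaximalIsotropic M →
        ∀ bc : QuantumGraph.BoundaryConditions (QuantumGraph.BoundarySpace I E),
          bc.subspace = M →
          QuantumGraph.FormBoundedBelow (-G.laplacian M) (-((s ‖bc.kuchmentPos‖) ^ 2)) := by
  have hex := fun t : {t : ℝ // 0 ≤ t} => Real.exists_mul_tanh_eq G.minLength_pos t.2
  choose σ hσ0 hσ using hex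
  -- `σ` lives on `t ≥ 0`; replacing `t` by `max t 0` extends it to all reals, with the irrelevant
  -- value `σ 0` at negative `t`.
  have hs : ∀ t (ht : 0 ≤ t), σ ⟨max t 0, le_max_right _ _⟩ = σ ⟨t, ht⟩ := fun t ht => by
    congr 2
    exact max_eq_left ht
  refine ⟨fun t => σ ⟨max t 0, le_max_right _ _⟩, fun t ht => ?_, ?_⟩
  · simp only [hs t ht]
    exact ⟨⟨hσ0 _, hσ _⟩, fun r hr h => (Real.strictMonoOn_mul_tanh G.minLength_pos).injOn
      hr (hσ0 ⟨t, ht⟩) (h.trans (hσ ⟨t, ht⟩).symm)⟩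
  · rintro M - bc rfl ψ
    have hmem : ((ψ : G.HilbertSpace), G.laplacian bc.subspace ψ) ∈ G.laplacianGraph bc.subspace :=
      G.mem_laplacian_graph.1 (LinearPMap.mem_graph _ _)
    obtain ⟨f, g, h, hM⟩ := hmem
    obtain ⟨D, hD, hle⟩ := G.exists_energy h
    have him := bc.inner_im_eq_zero hM
    have hre := bc.neg_norm_kuchmentPos_le_re_inner hM
    have ht := norm_nonneg bc.kuchmentPos
    -- At `s = s(‖L₊‖)` the weight in the trace inequality is exactly `‖L₊‖`, which cancels the
    -- lower bound `hre` for the boundary term.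
    have hineq := hle _ (hσ0 ⟨_, ht⟩)
    rw [hσ] at hineq
    simp only [hs _ ht]
    have heq : inner ℂ (ψ : G.HilbertSpace) ((-G.laplacian bc.subspace) ψ) =
        (D : ℂ) + inner ℂ (G.boundaryValue f) (G.boundaryDeriv g) := by
      rw [LinearPMap.neg_apply, inner_neg_right]
      linear_combination -hD
    rw [heq, Complex.add_im, Complex.add_re, Complex.ofReal_im, Complex.ofReal_re]
    refine ⟨by rw [zero_add]; exact him, ?_⟩
    linarith
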